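/- **Corollary (Robust estimator for $p$).** Fix $p\in(0,1)$. For $r>0$ let $\mathrm{NegBin}(r,p)$ denote the distribution on $\{0,1,2,\dots\}$ with probability mass function $$P_{r,p}(k)=\frac{\Gamma(r+k)}{\Gamma(r)\,k!}\,(1-p)^r p^k .$$ For every $r>0$, let $K_1,K_2,\dots\sim\mathrm{NegBin}(r,p)$ and $U_1,U_2,\dots\sim\mathrm{Uniform}(0,1)$ be mutually independent random variables, defined on a probability space with probability measure $\mathbb P_r$, and put $X_i=K_i+U_i$. For each $n$ let $\hat m_{n,r}$ be a sample median of $X_1,\dots,X_n$, that is, any number such that at least half of the $X_i$ ($i\le n$) are $\le\hat m_{n,r}$ and at least half of them are $\ge\hat m_{n,r}$. Define $$\hat p_{n,r}=\frac{\hat m_{n,r}-\frac13}{\hat m_{n,r}-\frac23+r}.$$ Then $\hat p_{n,r}$ converges in probability to $p$ as $n\to\infty$ and then $r\to\infty$ (over the positive reals), in the following sense: 1. there is a function $c:\mathbb R\to\mathbb R$ such that, for all sufficiently large $r$, $\hat p_{n,r}\to c(r)$ in $\mathbb P_r$-probability as $n\to\infty$, and $c(r)\to p$ as $r\to\infty$;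 2. for every $\varepsilon>0$, $\displaystyle\lim_{r\to\infty}\,\limsup_{n\to\infty}\,\mathbb P_r\big(|\hat p_{n,r}-p|\ge\varepsilon\big)=0$. (If the sample medians are chosen non-measurably, $\mathbb P_r$ is read as outer probability.) -/

import Mathlib

open MeasureTheory ProbabilityTheory Filter Topology

/-- The probability mass function of the negative binomial distribution `NegBin(r, p)`:
`P(K = k) = Γ(r + k) / (Γ(r) k!) * (1 - p)^r * p^k` for `k = 0, 1, 2, …`. -/
noncomputable def negBinPMFReal (r p : ℝ) (k : ℕ) : ℝ :=
  Real.Gamma (r + k) / (Real.Gamma r * (k.factorial : ℝ)) * (1 - p) ^ r * p ^ k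

/-- The negative binomial distribution `NegBin(r, p)` as a measure on `ℕ`. -/
noncomputable def negBinMeasure (r p : ℝ) : Measure ℕ :=
  Measure.sum (fun k : ℕ => ENNReal.ofReal (negBinPMFReal r p k) • Measure.dirac k)

/-- `(K 0, U 0), (K 1, U 1), …` are independent pairs on `(Ω, P)`, and in each pair
`K i ∼ NegBin(r, p)` and `U i ∼ Uniform(0, 1)` are independent. Equivalently: all the variables
`K i`, `U j` are mutually independent, with these laws. -/
structure IsNegBinUniformSample {Ω : Type*} [MeasurableSpace Ω] (P : Measure Ω) (r p : ℝ)
    (K : ℕ → Ω → ℕ) (U : ℕ → Ω → ℝ) : Prop where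
  hasLaw_K : ∀ i, HasLaw (K i) (negBinMeasure r p) P
  hasLaw_U : ∀ i, pdf.IsUniform (U i) (Set.Ioo (0 : ℝ) 1) P volume
  indep_pair : ∀ i, IndepFun (K i) (U i) P
  indep_pairs : iIndepFun (fun i ω => (K i ω, U i ω)) P

/-- `m` is a sample median of `x₁, …, xₙ`: at least half of the observations are `≤ m` and at least
half of them are `≥ m`. For odd `n` this is the middle order statistic; for even `n` it is any
point between the two middle order statistics, so that every usual convention (lower median
`inf {t : Fₙ(t) ≥ 1/2}`, upper median, midpoint) is covered. -/
def IsSampleMedian {n : ℕ} (x : Fin n → ℝ) (m : ℝ) : Prop :=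
  n ≤ 2 * (Finset.univ.filter (fun i => x i ≤ m)).card ∧
  n ≤ 2 * (Finset.univ.filter (fun i => m ≤ x i)).card

/-- The plug-in estimator `(m - 1/3) / (m - 2/3 + r)` of `p`, where `m` is a sample median. -/
noncomputable def robustEstimator (r m : ℝ) : ℝ :=
  (m - 1 / 3) / (m - 2 / 3 + r)

/-! Write `q = p / (1 - p)`. For fixed `r` the law of `K + U` charges every interval in `(0, ∞)`, so
its median `m r` is unique and sample medians converge to it in probability
(`tendstoInMeasure_sampleMedian`). `NegBin(r, p)` has mean `r q` and variance `r (q² + q)`, both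
linear in `r`, so Chebyshev (`median_mem_Icc`) gives `m r / r → q`. The estimator evaluated at `m r`
then tends to `q / (q + 1) = p`; the constants `1/3` and `2/3` vanish in the limit. -/

/-! ### Moments of the negative binomial law and Chebyshev's inequality. -/

theorem Real.Gamma_add_natCast_eq_ascPochhammer {r : ℝ} (hr : 0 < r) (k : ℕ) :
    Real.Gamma (r + k) = Real.Gamma r * (ascPochhammer ℝ k).eval r := by
  induction k with
  | zero => simp
  | succ k ih =>
    rw [Nat.cast_succ, ← add_assoc, Real.Gamma_add_one (by positivity), ih,
      ascPochhammer_succ_eval]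
    ring

theorem negBinPMFReal_eq_choose {r : ℝ} (hr : 0 < r) (p : ℝ) (k : ℕ) :
    negBinPMFReal r p k = (1 - p) ^ r * (Ring.choose (r + k - 1) k * p ^ k) := by
  have h := Ring.factorial_nsmul_multichoose_eq_ascPochhammer r k
  rw [Polynomial.ascPochhammer_smeval_eq_eval, Ring.multichoose_eq, nsmul_eq_mul] at h
  have hG := (Real.Gamma_pos_of_pos hr).ne'
  have hk : (k.factorial : ℝ) ≠ 0 := by positivity
  rw [negBinPMFReal, Real.Gamma_add_natCast_eq_ascPochhammer hr, ← h]
  field_simp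

theorem negBinPMFReal_pos {r p : ℝ} (hr : 0 < r) (hp : p ∈ Set.Ioo (0 : ℝ) 1) (k : ℕ) :
    0 < negBinPMFReal r p k := by
  have h1 : 0 < 1 - p := sub_pos.2 hp.2
  have h0 := hp.1
  have hG := Real.Gamma_pos_of_pos hr
  have hG' : 0 < Real.Gamma (r + k) := Real.Gamma_pos_of_pos (by positivity)
  unfold negBinPMFReal
  positivity

/-- This is the binomial series of `(1 - p) ^ (-r)`. -/
theorem hasSum_negBinPMFReal {r p : ℝ} (hr : 0 < r) (hp : p ∈ Set.Ioo (0 : ℝ) 1) :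
    HasSum (negBinPMFReal r p) 1 := by
  have h1 : 0 < 1 - p := sub_pos.2 hp.2
  have hmem : p ∈ Metric.eball (0 : ℝ) 1 := by
    simp [← ENNReal.ofReal_one, Metric.eball_ofReal, abs_of_pos hp.1, hp.2]
  have h := (Real.one_div_one_sub_rpow_hasFPowerSeriesOnBall_zero r).hasSum hmem
  have h2 := h.mul_left ((1 - p) ^ r)
  have hpos : 0 < (1 - p) ^ r := Real.rpow_pos_of_pos h1 r
  convert! h2 using 1
  · ext k
    rw [negBinPMFReal_eq_choose hr]
    simp [FormalMultilinearSeries.ofScalars, mul_comm]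
  · simp [hpos.ne']

/-- Size-biasing shifts `r` to `r + 1`, so each factorial moment reduces to the previous one,
starting from total mass 1. -/
theorem succ_mul_negBinPMFReal_succ {r p : ℝ} (hr : 0 < r) (hp : p ∈ Set.Ioo (0 : ℝ) 1) (k : ℕ) :
    ((k + 1 : ℕ) : ℝ) * negBinPMFReal r p (k + 1) =
      r * (p / (1 - p)) * negBinPMFReal (r + 1) p k := by
  have h1 : 0 < 1 - p := sub_pos.2 hp.2
  have hG := (Real.Gamma_pos_of_pos hr).ne'
  have hk : (k.factorial : ℝ) ≠ 0 := by positivity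
  have hk1 : (k : ℝ) + 1 ≠ 0 := by positivity
  have e : r + ((k + 1 : ℕ) : ℝ) = r + 1 + k := by push_cast; ring
  rw [negBinPMFReal, negBinPMFReal, e, Real.Gamma_add_one hr.ne', Real.rpow_add_one h1.ne',
    Nat.factorial_succ, pow_succ]
  push_cast
  field_simp

theorem hasSum_mul_negBinPMFReal {r p : ℝ} (hr : 0 < r) (hp : p ∈ Set.Ioo (0 : ℝ) 1) :
    HasSum (fun k : ℕ => (k : ℝ) * negBinPMFReal r p k) (r * (p / (1 - p))) := by
  rw [← hasSum_nat_add_iff' 1]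
  simp only [succ_mul_negBinPMFReal_succ hr hp]
  simpa using (hasSum_negBinPMFReal (r := r + 1) (by positivity) hp).mul_left (r * (p / (1 - p)))

theorem hasSum_mul_pred_mul_negBinPMFReal {r p : ℝ} (hr : 0 < r) (hp : p ∈ Set.Ioo (0 : ℝ) 1) :
    HasSum (fun k : ℕ => ((k : ℝ) - 1) * (k * negBinPMFReal r p k))
      (r * (p / (1 - p)) * ((r + 1) * (p / (1 - p)))) := by
  rw [← hasSum_nat_add_iff' 1]
  simp only [succ_mul_negBinPMFReal_succ hr hp]
  convert! (hasSum_mul_negBinPMFReal (r := r + 1) (by positivity) hp).mul_left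
    (r * (p / (1 - p))) using 1
  · ext k
    push_cast
    ring
  · simp

theorem hasSum_sq_sub_mul_negBinPMFReal {r p : ℝ} (hr : 0 < r) (hp : p ∈ Set.Ioo (0 : ℝ) 1) :
    HasSum (fun k : ℕ => negBinPMFReal r p k * ((k : ℝ) - r * (p / (1 - p))) ^ 2)
      (r * ((p / (1 - p)) ^ 2 + p / (1 - p))) := by
  have h := ((hasSum_mul_pred_mul_negBinPMFReal hr hp).add
    ((hasSum_mul_negBinPMFReal hr hp).mul_left (1 - 2 * (r * (p / (1 - p)))))).add
    ((hasSum_negBinPMFReal hr hp).mul_left ((r * (p / (1 - p))) ^ 2))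
  convert! h using 1
  · ext k
    ring
  · ring

theorem lintegral_negBinMeasure (r p : ℝ) (f : ℕ → ENNReal) :
    ∫⁻ k, f k ∂negBinMeasure r p = ∑' k, ENNReal.ofReal (negBinPMFReal r p k) * f k := by
  simp [negBinMeasure, lintegral_sum_measure]

theorem negBinMeasure_singleton_pos {r p : ℝ} (hr : 0 < r) (hp : p ∈ Set.Ioo (0 : ℝ) 1) (k : ℕ) :
    0 < negBinMeasure r p {k} := by
  refine lt_of_lt_of_le ?_ (Measure.le_sum_apply _ _ |>.trans' <|
    ENNReal.le_tsum (f := fun j => (ENNReal.ofReal (negBinPMFReal r p j) • Measure.dirac j) {k}) k)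
  simp [negBinPMFReal_pos hr hp k]

theorem negBinMeasure_abs_sub_mean_ge_le {r p t : ℝ} (hr : 0 < r) (hp : p ∈ Set.Ioo (0 : ℝ) 1)
    (ht : 0 < t) :
    negBinMeasure r p {k | t ≤ |(k : ℝ) - r * (p / (1 - p))|} ≤
      ENNReal.ofReal (r * ((p / (1 - p)) ^ 2 + p / (1 - p)) / t ^ 2) := by
  have hV := hasSum_sq_sub_mul_negBinPMFReal hr hp
  have hm := meas_ge_le_lintegral_div (μ := negBinMeasure r p)
    (f := fun k : ℕ => ENNReal.ofReal (((k : ℝ) - r * (p / (1 - p))) ^ 2))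
    (by fun_prop) (ε := ENNReal.ofReal (t ^ 2)) (by simpa using by positivity) (by simp)
  rw [lintegral_negBinMeasure] at hm
  simp_rw [← ENNReal.ofReal_mul (negBinPMFReal_pos hr hp _).le] at hm
  rw [← ENNReal.ofReal_tsum_of_nonneg
    (fun k => mul_nonneg (negBinPMFReal_pos hr hp k).le (sq_nonneg _)) hV.summable, hV.tsum_eq,
    ← ENNReal.ofReal_div_of_pos (by positivity)] at hm
  refine le_trans (measure_mono fun k hk => ?_) hm
  exact ENNReal.ofReal_le_ofReal (by rw [← sq_abs (_ - _)]; exact pow_le_pow_left₀ ht.le hk 2)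

/-! ### Consistency of sample medians and uniqueness of the median. -/

/-- By the law of large numbers for the indicator of `s`, the empirical frequency of `s` settles
strictly below `1/2`. -/
theorem tendsto_measure_two_mul_card_ge {Ω : Type*} [MeasurableSpace Ω] {P : Measure Ω}
    [IsProbabilityMeasure P] {X : ℕ → Ω → ℝ} (hindep : iIndepFun X P)
    (hident : ∀ i, IdentDistrib (X i) (X 0) P P) {s : Set ℝ} [DecidablePred (· ∈ s)]
    (hs : MeasurableSet s) (hlt : P {ω | X 0 ω ∈ s} < 1 / 2) :
    Tendsto (fun n : ℕ => P {ω | n ≤ 2 * (Finset.univ.filter (fun i : Fin n => X i ω ∈ s)).card})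
      atTop (𝓝 0) := by
  set g : ℝ → ℝ := s.indicator 1 with hg
  have hgm : Measurable g := measurable_one.indicator hs
  have hident' : ∀ i, IdentDistrib (g ∘ X i) (g ∘ X 0) P P := fun i => (hident i).comp hgm
  have hmeas : ∀ i, AEMeasurable (g ∘ X i) P := fun i => (hident' i).aemeasurable_fst
  have hint : Integrable (g ∘ X 0) P := by
    refine Integrable.of_bound (hmeas 0).aestronglyMeasurable 1 (ae_of_all _ fun ω => ?_)
    by_cases h : X 0 ω ∈ s <;> simp [hg, h]
  have hslln := strong_law_ae_real (fun i => g ∘ X i) hint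
    (fun i j hij => (hindep.indepFun hij).comp hgm hgm) hident'
  have hnull : NullMeasurableSet (X 0 ⁻¹' s) P :=
    (hident 0).aemeasurable_fst.nullMeasurableSet_preimage hs
  have hmean : ∫ ω, (g ∘ X 0) ω ∂P = P.real (X 0 ⁻¹' s) := by
    have : g ∘ X 0 = (X 0 ⁻¹' s).indicator 1 := by
      ext ω; by_cases h : X 0 ω ∈ s <;> simp [hg, h]
    rw [this, integral_indicator₀ hnull]
    simp
  have hmlt : P.real (X 0 ⁻¹' s) < 1 / 2 := by
    have := ENNReal.toReal_strict_mono (by simp) hlt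
    rwa [show (1 / 2 : ENNReal).toReal = 1 / 2 by simp] at this
  have hprob := tendstoInMeasure_of_tendsto_ae (f := fun (n : ℕ) ω =>
    (∑ i ∈ Finset.range n, (g ∘ X i) ω) / n) (μ := P)
    (fun n => ((Finset.aemeasurable_fun_sum _ fun i _ => hmeas i).div_const _).aestronglyMeasurable)
    hslln
  rw [tendstoInMeasure_iff_dist] at hprob
  refine tendsto_of_tendsto_of_tendsto_of_le_of_le' tendsto_const_nhds
    (hprob (1 / 2 - P.real (X 0 ⁻¹' s)) (sub_pos.2 hmlt)) (Eventually.of_forall fun _ => zero_le)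
    ?_
  -- For `n = 0` the event is the whole space.
  filter_upwards [eventually_gt_atTop 0] with n hn
  refine measure_mono fun ω hω => ?_
  have hcard : ∑ i ∈ Finset.range n, (g ∘ X i) ω =
      ((Finset.univ.filter (fun i : Fin n => X i ω ∈ s)).card : ℝ) := by
    rw [Finset.sum_range, Finset.card_filter]
    push_cast
    exact Finset.sum_congr rfl fun i _ => by simp [hg, Set.indicator_apply]
  have hn' : (0 : ℝ) < n := by exact_mod_cast hn
  have hω' : (n : ℝ) ≤ 2 * ((Finset.univ.filter (fun i : Fin n => X i ω ∈ s)).card : ℝ) := by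
    exact_mod_cast hω
  simp only [Set.mem_ofPred_eq, hmean, hcard, Real.dist_eq]
  refine le_trans ?_ (le_abs_self _)
  have : 1 / 2 ≤ ((Finset.univ.filter (fun i : Fin n => X i ω ∈ s)).card : ℝ) / n := by
    rw [le_div_iff₀ hn']; linarith
  linarith

/-- Sample medians are consistent for a median `c` that is unique: no smaller and no larger number
is a median of the common law. -/
theorem tendstoInMeasure_sampleMedian {Ω : Type*} [MeasurableSpace Ω] {P : Measure Ω}
    [IsProbabilityMeasure P] {X : ℕ → Ω → ℝ} (hindep : iIndepFun X P)
    (hident : ∀ i, IdentDistrib (X i) (X 0) P P) {c : ℝ}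
    (hlow : ∀ a < c, P {ω | X 0 ω ≤ a} < 1 / 2) (hhigh : ∀ b > c, P {ω | b ≤ X 0 ω} < 1 / 2)
    {M : ℕ → Ω → ℝ} (hM : ∀ n ω, IsSampleMedian (fun i : Fin n => X i ω) (M n ω)) :
    TendstoInMeasure P M atTop (fun _ => c) := by
  rw [tendstoInMeasure_iff_dist]
  intro ε hε
  have h1 := tendsto_measure_two_mul_card_ge hindep hident (s := Set.Iic (c - ε))
    measurableSet_Iic (hlow _ (by linarith))
  have h2 := tendsto_measure_two_mul_card_ge hindep hident (s := Set.Ici (c + ε))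
    measurableSet_Ici (hhigh _ (by linarith))
  refine tendsto_of_tendsto_of_tendsto_of_le_of_le tendsto_const_nhds (by simpa using h1.add h2)
    (fun _ => zero_le) fun n => ?_
  -- A median off by `ε` puts half the sample in one of the two tails. Only monotonicity is used, so
  -- `M` need not be measurable.
  refine le_trans (measure_mono fun ω hω => ?_) (measure_union_le _ _)
  simp only [Set.mem_ofPred_eq, Real.dist_eq, le_abs] at hω
  rcases hω with hω | hω
  · right
    refine (hM n ω).2.trans ?_
    refine Nat.mul_le_mul_left _ (Finset.card_le_card fun i hi => ?_)
    simp only [Finset.mem_filter, Finset.mem_univ, true_and] at hi ⊢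
    linarith
  · left
    refine (hM n ω).1.trans ?_
    refine Nat.mul_le_mul_left _ (Finset.card_le_card fun i hi => ?_)
    simp only [Finset.mem_filter, Finset.mem_univ, true_and] at hi ⊢
    linarith

/-- Take the least `c` with half the mass to its left. Half the mass beyond some `b > c` would leave
none for a gap `(t, b)`, which has positive mass. -/
theorem exists_unique_median_of_forall_Ioo_pos (μ : Measure ℝ) [IsProbabilityMeasure μ]
    (h0 : μ (Set.Iic 0) = 0) (hpos : ∀ a b, 0 ≤ a → a < b → 0 < μ (Set.Ioo a b)) :
    ∃ c, 0 ≤ c ∧ (∀ a < c, μ (Set.Iic a) < 1 / 2) ∧ ∀ b > c, μ (Set.Ici b) < 1 / 2 := by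
  set S : Set ℝ := {t | 1 / 2 ≤ μ (Set.Iic t)} with hS
  have hS0 : ∀ t ∈ S, 0 ≤ t := by
    intro t ht
    by_contra! hlt
    have h : μ (Set.Iic t) = 0 := measure_mono_null (Set.Iic_subset_Iic.2 hlt.le) h0
    rw [hS, Set.mem_ofPred_eq, h] at ht
    simp at ht
  have hne : S.Nonempty := by
    have h := tendsto_measure_Iic_atTop μ
    rw [measure_univ] at h
    obtain ⟨t, ht⟩ := (h.eventually_const_le (u := 1 / 2)
      (by simp)).exists
    exact ⟨t, ht⟩
  have hbdd : BddBelow S := ⟨0, hS0⟩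
  refine ⟨sInf S, le_csInf hne hS0, fun a ha => ?_, fun b hb => ?_⟩
  · by_contra! h
    exact (csInf_le hbdd h).not_gt ha
  · obtain ⟨t, htS, htb⟩ := exists_lt_of_csInf_lt hne hb
    by_contra! h
    have hsum : μ (Set.Iic t) + μ (Set.Ioo t b) + μ (Set.Ici b) = 1 := by
      rw [← measure_union (by rw [Set.disjoint_left]; intro x hx hx'; exact hx.not_gt hx'.1)
        measurableSet_Ioo, Set.Iic_union_Ioo_eq_Iio htb, ← measure_union
        (by rw [Set.disjoint_left]; intro x hx hx'; exact (lt_irrefl b) (hx'.trans_lt hx)) measurableSet_Ici,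
        Set.Iio_union_Ici, measure_univ]
    have h1 : (1 : ENNReal) < 1 := by
      calc (1 : ENNReal) = 1 / 2 + 1 / 2 := (ENNReal.add_halves 1).symm
        _ < (1 / 2 + μ (Set.Ioo t b)) + 1 / 2 := by
          refine ENNReal.add_lt_add_right (by simp) ?_
          exact ENNReal.lt_add_right (by simp) (hpos t b (hS0 t htS) htb).ne'
        _ ≤ μ (Set.Iic t) + μ (Set.Ioo t b) + μ (Set.Ici b) := by gcongr; exact htS
        _ = 1 := hsum
    exact h1.false

/-! ### The law of `K + U` and the location of its median. -/

namespace IsNegBinUniformSample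

variable {Ω : Type*} [MeasurableSpace Ω] {P : Measure Ω} {r p : ℝ}
  {K : ℕ → Ω → ℕ} {U : ℕ → Ω → ℝ}

theorem aemeasurable_U (h : IsNegBinUniformSample P r p K U) (i : ℕ) : AEMeasurable (U i) P :=
  (h.hasLaw_U i).aemeasurable (by simp) (by simp)

theorem aemeasurable_add (h : IsNegBinUniformSample P r p K U) (i : ℕ) :
    AEMeasurable (fun ω => (K i ω : ℝ) + U i ω) P :=
  (measurable_from_nat.comp_aemeasurable (h.hasLaw_K i).aemeasurable).add (h.aemeasurable_U i)

theorem measure_U_mem (h : IsNegBinUniformSample P r p K U) (i : ℕ) {s : Set ℝ}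
    (hs : MeasurableSet s) : P (U i ⁻¹' s) = volume (Set.Ioo 0 1 ∩ s) := by
  rw [(h.hasLaw_U i).measure_preimage (by simp) (by simp) hs]
  simp

theorem ae_U_mem_Ioo (h : IsNegBinUniformSample P r p K U) (i : ℕ) :
    ∀ᵐ ω ∂P, U i ω ∈ Set.Ioo (0 : ℝ) 1 := by
  have := h.measure_U_mem i (measurableSet_Ioo (a := (0 : ℝ)) (b := 1)).compl
  rw [Set.inter_compl_self, measure_empty] at this
  exact this

theorem iIndepFun_add (h : IsNegBinUniformSample P r p K U) :
    iIndepFun (fun i ω => (K i ω : ℝ) + U i ω) P :=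
  h.indep_pairs.comp (fun _ x => (x.1 : ℝ) + x.2)
    (fun _ => (measurable_from_nat.comp measurable_fst).add measurable_snd)

theorem identDistrib_add [IsProbabilityMeasure P]
    (h : IsNegBinUniformSample P r p K U) (i : ℕ) :
    IdentDistrib (fun ω => (K i ω : ℝ) + U i ω) (fun ω => (K 0 ω : ℝ) + U 0 ω) P P := by
  have hK := fun i => (h.hasLaw_K i).aemeasurable
  have hpair : IdentDistrib (fun ω => (K i ω, U i ω)) (fun ω => (K 0 ω, U 0 ω)) P P := by
    refine ⟨(hK i).prodMk (h.aemeasurable_U i), (hK 0).prodMk (h.aemeasurable_U 0), ?_⟩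
    rw [(h.indep_pair i).map_prod_eq_prod_map_map (hK i) (h.aemeasurable_U i),
      (h.indep_pair 0).map_prod_eq_prod_map_map (hK 0) (h.aemeasurable_U 0),
      (h.hasLaw_K i).map_eq, (h.hasLaw_K 0).map_eq, h.hasLaw_U i, h.hasLaw_U 0]
  exact hpair.comp (u := fun x : ℕ × ℝ => (x.1 : ℝ) + x.2)
    ((measurable_from_nat.comp measurable_fst).add measurable_snd)

theorem measure_add_mem_Ioo_pos (h : IsNegBinUniformSample P r p K U) (hr : 0 < r)
    (hp : p ∈ Set.Ioo (0 : ℝ) 1) (i : ℕ) {a b : ℝ} (ha : 0 ≤ a) (hab : a < b) :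
    0 < P {ω | (K i ω : ℝ) + U i ω ∈ Set.Ioo a b} := by
  have hfl := Nat.floor_le ha
  have hfl' := Nat.lt_floor_add_one a
  -- It suffices that `K = k` and that `U` falls in the part of `(a - k, b - k)` below 1.
  set k := ⌊a⌋₊
  set s := Set.Ioo (a - k) (min (b - k) 1)
  have hsub : P (K i ⁻¹' {k} ∩ U i ⁻¹' s) ≤ P {ω | (K i ω : ℝ) + U i ω ∈ Set.Ioo a b} := by
    refine measure_mono fun ω hω => ?_
    obtain ⟨hk, hu1, hu2⟩ := hω
    have hk' : K i ω = k := hk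
    have := hu2.trans_le (min_le_left _ _)
    simp only [Set.mem_ofPred_eq, hk', Set.mem_Ioo]
    constructor <;> linarith
  refine lt_of_lt_of_le ?_ hsub
  rw [(h.indep_pair i).measure_inter_preimage_eq_mul _ _ (measurableSet_singleton k)
    measurableSet_Ioo, h.measure_U_mem i measurableSet_Ioo,
    ← Measure.map_apply_of_aemeasurable (h.hasLaw_K i).aemeasurable (measurableSet_singleton k),
    (h.hasLaw_K i).map_eq, Set.inter_eq_self_of_subset_right
      (Set.Ioo_subset_Ioo (by linarith) (min_le_right _ _))]
  refine ENNReal.mul_pos (negBinMeasure_singleton_pos hr hp k).ne' ?_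
  rw [Real.volume_Ioo]
  simp only [ne_eq, ENNReal.ofReal_eq_zero, not_le, sub_pos, lt_min_iff]
  constructor <;> linarith

theorem exists_unique_median [IsProbabilityMeasure P]
    (h : IsNegBinUniformSample P r p K U) (hr : 0 < r) (hp : p ∈ Set.Ioo (0 : ℝ) 1) :
    ∃ c, 0 ≤ c ∧ (∀ a < c, P {ω | (K 0 ω : ℝ) + U 0 ω ≤ a} < 1 / 2) ∧
      ∀ b > c, P {ω | b ≤ (K 0 ω : ℝ) + U 0 ω} < 1 / 2 := by
  have hX := h.aemeasurable_add 0
  have := Measure.isProbabilityMeasure_map (μ := P) hX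
  obtain ⟨c, hc, h1, h2⟩ := exists_unique_median_of_forall_Ioo_pos
    (P.map fun ω => (K 0 ω : ℝ) + U 0 ω) (by
      rw [Measure.map_apply_of_aemeasurable hX measurableSet_Iic]
      refine measure_mono_null (fun ω hω => ?_) (h.ae_U_mem_Ioo 0)
      intro hU
      have hω' : (K 0 ω : ℝ) + U 0 ω ≤ 0 := hω
      have hK : (0 : ℝ) ≤ K 0 ω := Nat.cast_nonneg _
      linarith [hU.1]) (by
      intro a b ha hab
      rw [Measure.map_apply_of_aemeasurable hX measurableSet_Ioo]
      exact h.measure_add_mem_Ioo_pos hr hp 0 ha hab)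
  refine ⟨c, hc, fun a ha => ?_, fun b hb => ?_⟩
  · simpa [Measure.map_apply_of_aemeasurable hX measurableSet_Iic, Set.preimage] using h1 a ha
  · simpa [Measure.map_apply_of_aemeasurable hX measurableSet_Ici, Set.preimage] using h2 b hb

/-- A median of `K + U` lies within `t` of the mean of `K`, up to the shift by `U`, as soon as
Chebyshev's inequality bounds the probability of a deviation by `t` below `1 / 2`. -/
theorem median_mem_Icc [IsProbabilityMeasure P]
    (h : IsNegBinUniformSample P r p K U) (hr : 0 < r) (hp : p ∈ Set.Ioo (0 : ℝ) 1) {t c : ℝ} (ht : 0 < t)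
    (htr : r * ((p / (1 - p)) ^ 2 + p / (1 - p)) / t ^ 2 < 1 / 2)
    (hlow : ∀ a < c, P {ω | (K 0 ω : ℝ) + U 0 ω ≤ a} < 1 / 2)
    (hhigh : ∀ b > c, P {ω | b ≤ (K 0 ω : ℝ) + U 0 ω} < 1 / 2) :
    c ∈ Set.Icc (r * (p / (1 - p)) - t) (r * (p / (1 - p)) + t + 1) := by
  set D : Set ℕ := {k | t ≤ |(k : ℝ) - r * (p / (1 - p))|}
  have hD : P (K 0 ⁻¹' D) < 1 / 2 := by
    rw [← Measure.map_apply_of_aemeasurable (h.hasLaw_K 0).aemeasurable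
      (MeasurableSet.of_discrete), (h.hasLaw_K 0).map_eq]
    refine (negBinMeasure_abs_sub_mean_ge_le hr hp ht).trans_lt ?_
    rw [show (1 / 2 : ENNReal) = ENNReal.ofReal (1 / 2) by
      rw [ENNReal.ofReal_div_of_pos two_pos]; simp]
    exact (ENNReal.ofReal_lt_ofReal_iff (by norm_num)).2 htr
  -- Two events of probability below `1/2` cannot cover `Ω`, even up to a null set.
  have key : ∀ s : Set Ω, P s < 1 / 2 →
      ∃ ω, ω ∉ s ∧ |(K 0 ω : ℝ) - r * (p / (1 - p))| < t ∧ U 0 ω ∈ Set.Ioo (0 : ℝ) 1 := by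
    intro s hs
    by_contra! hcon
    have hle : P Set.univ ≤ P s + P (K 0 ⁻¹' D) := by
      refine (measure_mono_ae ?_).trans (measure_union_le _ _)
      filter_upwards [h.ae_U_mem_Ioo 0] with ω hω _
      by_contra hn
      rw [show (s ∪ K 0 ⁻¹' D) ω ↔ ω ∈ s ∪ K 0 ⁻¹' D from Iff.rfl, Set.mem_union, not_or] at hn
      exact hcon ω hn.1 (not_le.1 hn.2) hω
    have := hle.trans_lt (ENNReal.add_lt_add hs hD)
    rw [measure_univ, ENNReal.add_halves] at this
    exact this.false
  constructor
  · by_contra! hlt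
    obtain ⟨ω, hω, hK, hU⟩ := key _ (hhigh _ hlt)
    exact hω (by simp only [Set.mem_ofPred_eq]; linarith [(abs_lt.1 hK).1, hU.1])
  · by_contra! hlt
    obtain ⟨ω, hω, hK, hU⟩ := key _ (hlow _ hlt)
    exact hω (by simp only [Set.mem_ofPred_eq]; linarith [(abs_lt.1 hK).2, hU.2])

end IsNegBinUniformSample

/-! ### Passage to the estimator and the limit in `r`. -/

theorem MeasureTheory.TendstoInMeasure.comp_continuousAt_const {ι Ω E F : Type*} [MeasurableSpace Ω]
    [PseudoMetricSpace E] [PseudoMetricSpace F] {P : Measure Ω} {l : Filter ι} {f : ι → Ω → E}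
    {c : E} (hf : TendstoInMeasure P f l (fun _ => c)) {g : E → F} (hg : ContinuousAt g c) :
    TendstoInMeasure P (fun i ω => g (f i ω)) l (fun _ => g c) := by
  rw [tendstoInMeasure_iff_dist] at hf ⊢
  intro ε hε
  obtain ⟨δ, hδ, hδε⟩ := Metric.continuousAt_iff.1 hg ε hε
  refine tendsto_of_tendsto_of_tendsto_of_le_of_le tendsto_const_nhds (hf δ hδ)
    (fun _ => zero_le) fun i => measure_mono fun ω hω => ?_
  by_contra hn
  exact (hδε (not_le.1 hn)).not_ge hω

theorem tendsto_robustEstimator {q : ℝ} (hq : 0 < q) {m : ℝ → ℝ}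
    (hm : Tendsto (fun r => m r / r) atTop (𝓝 q)) :
    Tendsto (fun r => robustEstimator r (m r)) atTop (𝓝 (q / (q + 1))) := by
  have hinv : ∀ a : ℝ, Tendsto (fun r : ℝ => a / r) atTop (𝓝 0) := fun a =>
    tendsto_const_nhds.div_atTop tendsto_id
  have h := (hm.sub (hinv (1 / 3))).div ((hm.sub (hinv (2 / 3))).add_const 1)
    (by positivity)
  simp only [sub_zero] at h
  refine h.congr' ?_
  filter_upwards [eventually_gt_atTop 0] with r hr
  simp only [Pi.div_apply, robustEstimator]
  rw [← mul_div_mul_right _ (m r / r - 2 / 3 / r + 1) hr.ne']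
  congr 1 <;> field_simp

theorem mainTheorem6 (p : ℝ) (hp : p ∈ Set.Ioo (0 : ℝ) 1)
    (Ω : ℝ → Type*) [∀ r, MeasurableSpace (Ω r)]
    (P : ∀ r, Measure (Ω r)) [∀ r, IsProbabilityMeasure (P r)]
    (K : ∀ r, ℕ → Ω r → ℕ) (U : ∀ r, ℕ → Ω r → ℝ)
    (hKU : ∀ r, 0 < r → IsNegBinUniformSample (P r) r p (K r) (U r))
    (M : ∀ r, ℕ → Ω r → ℝ)
    (hM : ∀ r, 0 < r → ∀ (n : ℕ) (ω : Ω r),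
      IsSampleMedian (fun i : Fin n => (K r i ω : ℝ) + U r i ω) (M r n ω)) :
    (∃ c : ℝ → ℝ,
      (∀ᶠ r in atTop,
        TendstoInMeasure (P r) (fun n ω => robustEstimator r (M r n ω)) atTop (fun _ => c r)) ∧
      Tendsto c atTop (𝓝 p)) ∧
    (∀ ε : ℝ, 0 < ε →
      Tendsto
        (fun r => limsup (fun n => P r {ω | ε ≤ |robustEstimator r (M r n ω) - p|}) atTop)
        atTop (𝓝 0)) := by
  have h1p : 0 < 1 - p := sub_pos.2 hp.2
  set q := p / (1 - p) with hq
  have hq0 : 0 < q := div_pos hp.1 h1p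
  have hqp : q / (q + 1) = p := by rw [hq]; field_simp; ring
  choose! m hm0 hlow hhigh using fun r (hr : 0 < r) => (hKU r hr).exists_unique_median hr hp
  have hmq : Tendsto (fun r => m r / r) atTop (𝓝 q) := by
    rw [Metric.tendsto_atTop']
    intro ε hε
    -- With `t = ε r / 2`, the first bound makes the Chebyshev ratio less than `1/2`; the second
    -- makes the shift 1 due to `U` less than `ε r / 2`.
    refine ⟨max (2 * (q ^ 2 + q) / (ε / 2) ^ 2) (2 / ε), fun r hr => ?_⟩
    obtain ⟨hr1, hr2⟩ := max_lt_iff.1 hr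
    have hr0 : 0 < r := lt_trans (by positivity) hr1
    rw [div_lt_iff₀ (by positivity)] at hr1 hr2
    obtain ⟨hl, hu⟩ := (hKU r hr0).median_mem_Icc hr0 hp (t := ε / 2 * r) (by positivity)
      (by rw [div_lt_iff₀ (by positivity), ← hq]; nlinarith) (hlow r hr0) (hhigh r hr0)
    rw [← hq] at hl hu
    rw [Real.dist_eq, abs_lt, lt_sub_iff_add_lt, sub_lt_iff_lt_add, lt_div_iff₀ hr0,
      div_lt_iff₀ hr0]
    constructor <;> nlinarith
  have hc : Tendsto (fun r => robustEstimator r (m r)) atTop (𝓝 p) := by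
    simpa only [hqp] using tendsto_robustEstimator hq0 hmq
  -- As `m r ≥ 0`, `r > 1` keeps the denominator away from zero.
  have hprob : ∀ r > 1, TendstoInMeasure (P r) (fun n ω => robustEstimator r (M r n ω)) atTop
      (fun _ => robustEstimator r (m r)) := by
    intro r hr
    have hr0 : 0 < r := zero_lt_one.trans hr
    have hden : m r - 2 / 3 + r ≠ 0 := by linarith [hm0 r hr0]
    refine TendstoInMeasure.comp_continuousAt_const (tendstoInMeasure_sampleMedian
      (hKU r hr0).iIndepFun_add (hKU r hr0).identDistrib_add (hlow r hr0) (hhigh r hr0)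
      (hM r hr0)) ?_
    unfold robustEstimator
    fun_prop (disch := exact hden)
  refine ⟨⟨_, (eventually_gt_atTop 1).mono hprob, hc⟩, fun ε hε => ?_⟩
  -- The limsup equals 0 once `robustEstimator r (m r)` is within `ε / 2` of `p`.
  refine tendsto_const_nhds.congr' ?_
  filter_upwards [eventually_gt_atTop 1, hc (Metric.ball_mem_nhds p (half_pos hε))] with r hr hball
  have hball' : |robustEstimator r (m r) - p| < ε / 2 := hball
  have h := tendstoInMeasure_iff_dist.1 (hprob r hr) (ε / 2) (half_pos hε)
  refine (Tendsto.limsup_eq ?_).symm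
  refine tendsto_of_tendsto_of_tendsto_of_le_of_le tendsto_const_nhds h
    (fun _ => zero_le) fun n => measure_mono fun ω hω => ?_
  have hω' : ε ≤ |robustEstimator r (M r n ω) - p| := hω
  have := abs_sub_le (robustEstimator r (M r n ω)) (robustEstimator r (m r)) p
  simp only [Set.mem_ofPred_eq, Real.dist_eq]
  linarith
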